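/- Let $\beta>0$, $h>0$, $p\in[0,1]$ and $k>0$ be real numbers. The fluid model of the Tangle under a Tips Inflation Attack, with constant arrival rate $\beta$, delay $h$, honest fraction $p$ and $k$ parents per block, is the delay-differential system $$\dot x(t)=\beta-p\beta\,u(t),\qquad \dot l(t)=\beta-p\beta\,u(t-h),\qquad w(t)=l(t)-x(t)=\int_{t-h}^{t}p\beta\,u(s)\,ds,\qquad u(t)=\frac{k\,x(t)}{l(t)},$$ with continuous initial conditions on $[-h,0]$ satisfying $w=l-x$; the differential equations are required for $t>0$, the integral relation for $t\ge 0$, and $l$ must not vanish. Suppose $pk>1$. Then the system has exactly one constant solution, $$\hat x=\frac{h\beta}{pk-1},\qquad \hat l=\frac{pkh}{pk-1}\beta,\qquad \hat w=\frac{pkh-h}{pk-1}\beta,$$ its components are positive, and it is locally stable, in the following senses. (i) Every solution $(\zeta,\theta,\eta)$ of the system linearised at $(\hat x,\hat l,\hat w)$ (all of its equations, including the integral relation, being linearised) satisfies $\max\{|\zeta(t)|,|\theta(t)|,|\eta(t)|\}\to 0$ as $t\to\infty$. (ii) The spectrum of the linearised system, that is, the set of $z\in\mathbb C$ for which it has a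 nonzero solution $e^{zt}(\zeta,\theta,\eta)$ with constant $\zeta,\theta,\eta\in\mathbb C$, is the set of roots of $$c+\frac{c}{c-1}\,hz=e^{-hz},\qquad c=pk,$$ and every such root has $\operatorname{Re}z<0$. (iii) The constant solution is locally asymptotically stable for the nonlinear system. For every $\varepsilon>0$ there is $\delta>0$ such that a solution whose components are within $\delta$ of $(\hat x,\hat l,\hat w)$ on $[-h,0]$ stays within $\varepsilon$ of it for as long as it exists. Moreover there is $\delta>0$ such that every solution defined for all $t\ge0$ whose components are within $\delta$ of $(\hat x,\hat l,\hat w)$ on $[-h,0]$ converges to $(\hat x,\hat l,\hat w)$ as $t\to\infty$. -/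

import Mathlib

open Set Filter Topology

noncomputable section

/-- The expected number `u = k x / l` of free tips selected by a new honest block. -/
def selectionRate (k x l : ℝ) : ℝ := k * x / l

/-- `(x, l, w)` solves, on `[-h, T]`, the fluid model of the Tangle with `k` parents per block under
a Tips Inflation Attack, with arrival rate `a`, delay `h` and honest fraction `p`.  The values on
`[-h, 0]` are the (continuous) initial conditions; the delay equations hold for `0 < t < T` and the
integral relation for the pending tips on `[0, T]`, where all the delayed values are available. -/
structure IsTangleSolutionOn (a : ℝ → ℝ) (h p k T : ℝ) (x l w : ℝ → ℝ) : Prop where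
  continuousOn_x : ContinuousOn x (Icc (-h) T)
  continuousOn_l : ContinuousOn l (Icc (-h) T)
  l_ne_zero : ∀ t ∈ Icc (-h) T, l t ≠ 0
  deriv_x : ∀ t ∈ Ioo 0 T,
    HasDerivAt x (a (t - h) - p * a t * selectionRate k (x t) (l t)) t
  deriv_l : ∀ t ∈ Ioo 0 T,
    HasDerivAt l (a (t - h) - p * a (t - h) * selectionRate k (x (t - h)) (l (t - h))) t
  w_eq_sub : ∀ t ∈ Icc (-h) T, w t = l t - x t
  w_eq_integral : ∀ t ∈ Icc 0 T,
    w t = ∫ s in (t - h)..t, p * a s * selectionRate k (x s) (l s)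

/-- A solution on `[-h, ∞)`. -/
def IsTangleSolution (a : ℝ → ℝ) (h p k : ℝ) (x l w : ℝ → ℝ) : Prop :=
  ∀ T > 0, IsTangleSolutionOn a h p k T x l w

/-- On the initial interval `[-h, 0]` all three components are within `δ` of `(x₀, l₀, w₀)`. -/
def InitiallyClose (h δ x₀ l₀ w₀ : ℝ) (x l w : ℝ → ℝ) : Prop :=
  ∀ t ∈ Icc (-h) 0, |x t - x₀| < δ ∧ |l t - l₀| < δ ∧ |w t - w₀| < δ

/-- Local asymptotic stability (in the sense of Lyapunov) of the constant solution `(x₀, l₀, w₀)` of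
the nonlinear system.  The first field bounds every solution as long as it exists. -/
structure IsLocallyAsymptoticallyStable (a : ℝ → ℝ) (h p k x₀ l₀ w₀ : ℝ) : Prop where
  stable : ∀ ε > 0, ∃ δ > 0, ∀ T > 0, ∀ x l w : ℝ → ℝ,
    IsTangleSolutionOn a h p k T x l w → InitiallyClose h δ x₀ l₀ w₀ x l w →
      ∀ t ∈ Icc 0 T, |x t - x₀| < ε ∧ |l t - l₀| < ε ∧ |w t - w₀| < ε
  attractive : ∃ δ > 0, ∀ x l w : ℝ → ℝ,
    IsTangleSolution a h p k x l w → InitiallyClose h δ x₀ l₀ w₀ x l w →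
      Tendsto x atTop (𝓝 x₀) ∧ Tendsto l atTop (𝓝 l₀) ∧ Tendsto w atTop (𝓝 w₀)

/-- The derivative of `u = k x / l` at `(x₀, l₀)`, applied to the perturbation `(ζ, θ)`; real
perturbations have `V = ℝ`, exponential modes have `V = ℂ`. -/
def selectionRateLin {V : Type*} [NormedAddCommGroup V] [NormedSpace ℝ V]
    (k x₀ l₀ : ℝ) (ζ θ : V) : V :=
  deriv (fun x => selectionRate k x l₀) x₀ • ζ + deriv (fun l => selectionRate k x₀ l) l₀ • θ

/-- `(ζ, θ, η)` solves on `[-h, ∞)` the linearisation, around the constant solution with first two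
components `x₀, l₀`, of the system with constant arrival rate `β`. -/
structure IsLinearizedSolution {V : Type*} [NormedAddCommGroup V] [NormedSpace ℝ V]
    (β h p k x₀ l₀ : ℝ) (ζ θ η : ℝ → V) : Prop where
  continuousOn_ζ : ContinuousOn ζ (Ici (-h))
  continuousOn_θ : ContinuousOn θ (Ici (-h))
  deriv_ζ : ∀ t > 0,
    HasDerivAt ζ (-((p * β) • selectionRateLin k x₀ l₀ (ζ t) (θ t))) t
  deriv_θ : ∀ t > 0,
    HasDerivAt θ (-((p * β) • selectionRateLin k x₀ l₀ (ζ (t - h)) (θ (t - h)))) t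
  η_eq_sub : ∀ t ≥ -h, η t = θ t - ζ t
  η_eq_integral : ∀ t ≥ 0,
    η t = ∫ s in (t - h)..t, (p * β) • selectionRateLin k x₀ l₀ (ζ s) (θ s)

/-- Every solution of the linearised system tends to zero. -/
def IsLinearlyStable (β h p k x₀ l₀ : ℝ) : Prop :=
  ∀ ζ θ η : ℝ → ℝ, IsLinearizedSolution β h p k x₀ l₀ ζ θ η →
    Tendsto (fun t => max |ζ t| (max |θ t| |η t|)) atTop (𝓝 0)

/-- The spectrum of the linearised system: the `z` for which there is a nonzero solution of the form
`e ^ (z t) (ζ, θ, η)`. -/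
def linearizedSpectrum (β h p k x₀ l₀ : ℝ) : Set ℂ :=
  {z | ∃ ζ θ η : ℂ, (ζ, θ, η) ≠ 0 ∧
    IsLinearizedSolution β h p k x₀ l₀ (fun t : ℝ => Complex.exp (z * t) * ζ)
      (fun t : ℝ => Complex.exp (z * t) * θ) (fun t : ℝ => Complex.exp (z * t) * η)}

/-- The equilibrium number of free tips. -/
def xEq (β h p k : ℝ) : ℝ := h * β / (p * k - 1)

/-- The equilibrium number of tips. -/
def lEq (β h p k : ℝ) : ℝ := p * k * h / (p * k - 1) * β

/-- The equilibrium number of pending tips. -/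
def wEq (β h p k : ℝ) : ℝ := (p * k * h - h) / (p * k - 1) * β

end

/-!
Integrating the first equation over one delay and comparing with the integral relation gives
`l(t) = x(t - h) + hβ` for `t ≥ h`. With `y = x - x̂` and `c = pk`, the system thereby reduces to
the scalar delay equation `y'(t) = (β / l(t)) (y(t - h) - c y(t))`, and the linearised system to
the same equation with `l` frozen at `l̂`. Since `c > 1`, the undelayed damping dominates whatever
the delay is: if `β / l ≥ g₀ > 0`, then `ρ e^{-rt}` is a barrier for `|y|` as soon as
`r ≤ g₀ (c - e^{rh})`. In the nonlinear system the lower bound on `β / l` over one delay interval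
follows from the barrier over the preceding one, so the estimate propagates by the method of steps.
-/

section Comparison

theorem image_le_of_deriv_le_deriv_of_lt {f f' B B' : ℝ → ℝ} {a b : ℝ}
    (hf : ContinuousOn f (Icc a b)) (hf' : ∀ t ∈ Ioo a b, HasDerivAt f (f' t) t)
    (hB : ContinuousOn B (Icc a b)) (hB' : ∀ t ∈ Ioo a b, HasDerivAt B (B' t) t)
    (ha : f a ≤ B a) (bound : ∀ t ∈ Ioo a b, B t < f t → f' t ≤ B' t) :
    ∀ t ∈ Icc a b, f t ≤ B t := by
  intro t ht
  by_contra! hlt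
  have hcont : ContinuousOn (f - B) (Icc a t) := (hf.sub hB).mono (Icc_subset_Icc_right ht.2)
  have hclosed := hcont.preimage_isClosed_of_isClosed isClosed_Icc (isClosed_Iic (a := 0))
  obtain ⟨s, ⟨hs, hfs⟩, hlast⟩ :=
    (isCompact_Icc.of_isClosed_subset hclosed inter_subset_left).exists_isGreatest
      ⟨a, left_mem_Icc.2 ht.1, sub_nonpos.2 ha⟩
  replace hfs : f s ≤ B s := sub_nonpos.1 hfs
  have hst : s < t := hs.2.lt_of_ne fun hst => (hst ▸ hfs).not_gt hlt
  have hsub : ∀ ξ ∈ Ioo s t, ξ ∈ Ioo a b :=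
    fun ξ hξ => ⟨hs.1.trans_lt hξ.1, hξ.2.trans_le ht.2⟩
  obtain ⟨ξ, hξ, hslope⟩ := exists_hasDerivAt_eq_slope (f - B) (f' - B') hst
    (hcont.mono (Icc_subset_Icc_left hs.1))
    (fun ξ hξ => (hf' ξ (hsub ξ hξ)).sub (hB' ξ (hsub ξ hξ)))
  have habove : B ξ < f ξ := by
    by_contra! hle
    exact hξ.1.not_ge (hlast ⟨⟨(hsub ξ hξ).1.le, hξ.2.le⟩, sub_nonpos.2 hle⟩)
  have hpos : 0 < f' ξ - B' ξ := by
    rw [← Pi.sub_apply, hslope, Pi.sub_apply, Pi.sub_apply]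
    exact div_pos (by linarith) (sub_pos.2 hst)
  linarith [bound ξ (hsub ξ hξ) habove]

theorem abs_sub_le_of_abs_deriv_le {f f' : ℝ → ℝ} {a b C : ℝ} (hab : a ≤ b)
    (hf : ContinuousOn f (Icc a b)) (hf' : ∀ t ∈ Ioo a b, HasDerivAt f (f' t) t)
    (hC : ∀ t ∈ Ioo a b, |f' t| ≤ C) : |f b - f a| ≤ C * (b - a) := by
  rcases hab.eq_or_lt with rfl | hab
  · simp
  · obtain ⟨s, hs, hslope⟩ := exists_hasDerivAt_eq_slope f f' hab hf hf'
    have hs' := hC s hs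
    rwa [hslope, abs_div, abs_of_pos (sub_pos.2 hab), div_le_iff₀ (sub_pos.2 hab)] at hs'

theorem integral_eq_of_hasDerivAt_const_sub {V : Type*} [NormedAddCommGroup V] [NormedSpace ℝ V]
    [CompleteSpace V] {y v : ℝ → V} {e : V} {a b : ℝ} (hab : a ≤ b)
    (hy : ContinuousOn y (Icc a b)) (hv : ContinuousOn v (Icc a b))
    (hd : ∀ t ∈ Ioo a b, HasDerivAt y (e - v t) t) :
    ∫ s in a..b, v s = (b - a) • e - (y b - y a) := by
  have hint := hv.intervalIntegrable_of_Icc (μ := MeasureTheory.volume) hab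
  rw [← intervalIntegral.integral_eq_sub_of_hasDerivAt_of_le hab hy hd
      (intervalIntegrable_const.sub hint),
    intervalIntegral.integral_sub intervalIntegrable_const hint,
    intervalIntegral.integral_const, sub_sub_cancel]

end Comparison

section DelayRelaxation

variable {y m g : ℝ → ℝ} {T h c ρ r g₀ : ℝ}

theorem le_exp_of_forcing_le {q : ℝ} (hy : ContinuousOn y (Icc 0 T))
    (hd : ∀ t ∈ Ioo 0 T, HasDerivAt y (g t * (m t - c * y t)) t) (hc : 0 ≤ c) (hρ : 0 ≤ ρ)
    (h0 : y 0 ≤ ρ) (hg : ∀ t ∈ Ioo 0 T, 0 ≤ g t) (hr : ∀ t ∈ Ioo 0 T, r ≤ g t * (c - q))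
    (hm : ∀ t ∈ Ioo 0 T, m t ≤ q * (ρ * Real.exp (-(r * t)))) :
    ∀ t ∈ Icc 0 T, y t ≤ ρ * Real.exp (-(r * t)) := by
  have hB (t : ℝ) :
      HasDerivAt (fun t => ρ * Real.exp (-(r * t))) (-r * (ρ * Real.exp (-(r * t)))) t :=
    (((hasDerivAt_id' t).const_mul r).fun_neg.exp.const_mul ρ).congr_deriv (by ring)
  refine image_le_of_deriv_le_deriv_of_lt hy hd (by fun_prop) (fun t _ => hB t) (by simpa using h0)
    fun t ht hlt => ?_
  set B := ρ * Real.exp (-(r * t))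
  have : 0 ≤ B := mul_nonneg hρ (Real.exp_pos _).le
  calc g t * (m t - c * y t) ≤ g t * (q * B - c * B) := by
        gcongr
        exacts [hg t ht, hm t ht]
    _ = -(g t * (c - q)) * B := by ring
    _ ≤ -r * B := by
        gcongr
        exact hr t ht

theorem abs_le_exp_of_abs_forcing_le {q : ℝ} (hy : ContinuousOn y (Icc 0 T))
    (hd : ∀ t ∈ Ioo 0 T, HasDerivAt y (g t * (m t - c * y t)) t) (hc : 0 ≤ c) (h0 : |y 0| ≤ ρ)
    (hg : ∀ t ∈ Ioo 0 T, 0 ≤ g t) (hr : ∀ t ∈ Ioo 0 T, r ≤ g t * (c - q))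
    (hm : ∀ t ∈ Ioo 0 T, |m t| ≤ q * (ρ * Real.exp (-(r * t)))) :
    ∀ t ∈ Icc 0 T, |y t| ≤ ρ * Real.exp (-(r * t)) := by
  have hρ : 0 ≤ ρ := (abs_nonneg _).trans h0
  have hd_neg : ∀ t ∈ Ioo 0 T, HasDerivAt (-y) (g t * ((-m) t - c * (-y) t)) t :=
    fun t ht => (hd t ht).neg.congr_deriv (by simp only [Pi.neg_apply]; ring)
  exact fun t ht => abs_le'.2
    ⟨le_exp_of_forcing_le hy hd hc hρ ((le_abs_self _).trans h0) hg hr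
      (fun t ht => (le_abs_self _).trans (hm t ht)) t ht,
    le_exp_of_forcing_le hy.neg hd_neg hc hρ ((neg_le_abs _).trans h0) hg hr
      (fun t ht => (neg_le_abs _).trans (hm t ht)) t ht⟩

/-- `y` solves the delay equation `y'(t) = g(t) (y(t - h) - c y(t))` on `[0, T]`. The function `m`
stands for `t ↦ y(t - h)` from time `h` on, and carries the initial data on `[0, h)`. It is kept
separate because for the Tangle it is the deviation of `l`, which before time `h` is not a shift of
that of `x`. -/
structure IsDelayRelaxationOn (h c T : ℝ) (g m y : ℝ → ℝ) : Prop where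
  continuousOn : ContinuousOn y (Icc 0 T)
  hasDerivAt : ∀ t ∈ Ioo 0 T, HasDerivAt y (g t * (m t - c * y t)) t
  eq_delay : ∀ t ∈ Icc h T, m t = y (t - h)

theorem exists_pos_le_mul_sub_exp (h : ℝ) (hc : 1 < c) (hg₀ : 0 < g₀) :
    ∃ r > 0, r ≤ g₀ * (c - Real.exp (r * h)) := by
  have hnear : ∀ᶠ r in 𝓝 (0 : ℝ), r < g₀ * (c - Real.exp (r * h)) :=
    continuousAt_id.eventually_lt
      (by fun_prop : Continuous fun r : ℝ => g₀ * (c - Real.exp (r * h))).continuousAt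
      (by simpa using mul_pos hg₀ (sub_pos.2 hc))
  obtain ⟨r, hr, hr0⟩ := ((hnear.filter_mono nhdsWithin_le_nhds).and
    (self_mem_nhdsWithin (s := Ioi (0 : ℝ)))).exists
  exact ⟨r, hr0, hr.le⟩

namespace IsDelayRelaxationOn

theorem abs_delayed_le (H : IsDelayRelaxationOn h c T g m y) (hh : 0 ≤ h) (hr : 0 ≤ r)
    (hm : ∀ t ∈ Icc 0 T, t ≤ h → |m t| ≤ ρ) {S : ℝ}
    (hy : ∀ t ∈ Icc 0 T, t ≤ S → |y t| ≤ ρ * Real.exp (-(r * t))) :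
    ∀ t ∈ Icc 0 T, t ≤ S + h →
      |m t| ≤ ρ ∧ |m t| ≤ Real.exp (r * h) * (ρ * Real.exp (-(r * t))) := by
  intro t ht htS
  have hshift : Real.exp (r * h) * (ρ * Real.exp (-(r * t))) = ρ * Real.exp (-(r * (t - h))) := by
    rw [mul_left_comm, ← Real.exp_add]
    ring_nf
  rw [hshift]
  rcases le_total t h with hth | hth
  · have hρ : 0 ≤ ρ := (abs_nonneg _).trans (hm t ht hth)
    exact ⟨hm t ht hth,
      (hm t ht hth).trans (le_mul_of_one_le_right hρ (Real.one_le_exp (by nlinarith)))⟩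
  · rw [H.eq_delay t ⟨hth, ht.2⟩]
    have hb := hy (t - h) ⟨by linarith, by linarith [ht.2]⟩ (by linarith)
    have hρ : 0 ≤ ρ := nonneg_of_mul_nonneg_left ((abs_nonneg _).trans hb) (Real.exp_pos _)
    have hexp : Real.exp (-(r * (t - h))) ≤ 1 :=
      Real.exp_le_one_iff.2 (neg_nonpos.2 (mul_nonneg hr (sub_nonneg.2 hth)))
    exact ⟨hb.trans (mul_le_of_le_one_right hρ hexp), hb⟩

theorem abs_le_exp (H : IsDelayRelaxationOn h c T g m y) (hh : 0 < h) (hr : 0 ≤ r)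
    (hg₀ : 0 < g₀) (hrate : r ≤ g₀ * (c - Real.exp (r * h))) (h0 : |y 0| ≤ ρ)
    (hm : ∀ t ∈ Icc 0 T, t ≤ h → |m t| ≤ ρ) (hg : ∀ t ∈ Ioo 0 T, |m t| ≤ ρ → g₀ ≤ g t) :
    ∀ t ∈ Icc 0 T, |y t| ≤ ρ * Real.exp (-(r * t)) := by
  have hgap : 0 ≤ c - Real.exp (r * h) := (mul_nonneg_iff_of_pos_left hg₀).1 (hr.trans hrate)
  suffices hsteps : ∀ n : ℕ, ∀ t ∈ Icc 0 T, t ≤ n * h → |y t| ≤ ρ * Real.exp (-(r * t)) by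
    intro t ht
    obtain ⟨n, hn⟩ := exists_nat_ge (t / h)
    exact hsteps n t ht ((div_le_iff₀ hh).1 hn)
  intro n
  induction n with
  | zero =>
    intro t ht hn
    obtain rfl : t = 0 := le_antisymm (by simpa using hn) ht.1
    simpa using h0
  | succ n ih =>
    intro t ht hn
    have hdelayed : ∀ s ∈ Ioo 0 t,
        |m s| ≤ ρ ∧ |m s| ≤ Real.exp (r * h) * (ρ * Real.exp (-(r * s))) := fun s hs =>
      H.abs_delayed_le hh.le hr hm ih s ⟨hs.1.le, hs.2.le.trans ht.2⟩
        (hs.2.le.trans (hn.trans_eq (by push_cast; ring)))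
    have hg₀_le : ∀ s ∈ Ioo 0 t, g₀ ≤ g s := fun s hs =>
      hg s ⟨hs.1, hs.2.trans_le ht.2⟩ (hdelayed s hs).1
    exact abs_le_exp_of_abs_forcing_le (H.continuousOn.mono (Icc_subset_Icc_right ht.2))
      (fun s hs => H.hasDerivAt s ⟨hs.1, hs.2.trans_le ht.2⟩)
      ((Real.exp_pos _).le.trans (sub_nonneg.1 hgap)) h0
      (fun s hs => hg₀.le.trans (hg₀_le s hs))
      (fun s hs => hrate.trans (mul_le_mul_of_nonneg_right (hg₀_le s hs) hgap))
      (fun s hs => (hdelayed s hs).2) t (right_mem_Icc.2 ht.1)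

theorem abs_le (H : IsDelayRelaxationOn h c T g m y) (hh : 0 < h) (hc : 1 ≤ c) (hg₀ : 0 < g₀)
    (h0 : |y 0| ≤ ρ) (hm : ∀ t ∈ Icc 0 T, t ≤ h → |m t| ≤ ρ)
    (hg : ∀ t ∈ Ioo 0 T, |m t| ≤ ρ → g₀ ≤ g t) :
    ∀ t ∈ Icc 0 T, |y t| ≤ ρ ∧ |m t| ≤ ρ := by
  have hy : ∀ t ∈ Icc 0 T, |y t| ≤ ρ * Real.exp (-(0 * t)) :=
    H.abs_le_exp hh le_rfl hg₀ (by simpa using mul_nonneg hg₀.le (sub_nonneg.2 hc)) h0 hm hg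
  exact fun t ht => ⟨by simpa using hy t ht,
    (H.abs_delayed_le hh.le le_rfl hm (fun s hs _ => hy s hs) t ht (by linarith : t ≤ t + h)).1⟩

theorem tendsto_zero (H : ∀ T > 0, IsDelayRelaxationOn h c T g m y) (hh : 0 < h) (hc : 1 < c)
    (hg₀ : 0 < g₀) (h0 : |y 0| ≤ ρ) (hm : ∀ t ∈ Icc 0 h, |m t| ≤ ρ)
    (hg : ∀ t > 0, |m t| ≤ ρ → g₀ ≤ g t) :
    Tendsto y atTop (𝓝 0) ∧ Tendsto m atTop (𝓝 0) := by
  obtain ⟨r, hr, hrate⟩ := exists_pos_le_mul_sub_exp h hc hg₀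
  have hbound : ∀ t > 0, |y t| ≤ ρ * Real.exp (-(r * t)) := fun t ht =>
    (H t ht).abs_le_exp hh hr.le hg₀ hrate h0 (fun s hs hsh => hm s ⟨hs.1, hsh⟩)
      (fun s hs => hg s hs.1) t (right_mem_Icc.2 ht.le)
  have hexp : Tendsto (fun t : ℝ => ρ * Real.exp (-(r * t))) atTop (𝓝 0) := by
    simpa using (Real.tendsto_exp_neg_atTop_nhds_zero.comp
      (tendsto_id.const_mul_atTop hr)).const_mul ρ
  have hy : Tendsto y atTop (𝓝 0) :=
    squeeze_zero_norm' ((eventually_gt_atTop 0).mono hbound) hexp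
  refine ⟨hy, (hy.comp (tendsto_atTop_add_const_right atTop (-h) tendsto_id)).congr' ?_⟩
  exact (eventually_ge_atTop h).mono fun t ht =>
    ((H t (hh.trans_le ht)).eq_delay t ⟨ht, le_rfl⟩).symm

end IsDelayRelaxationOn

end DelayRelaxation

section Equilibrium

variable {β h p k : ℝ}

theorem lEq_eq_mul_xEq (β h p k : ℝ) : lEq β h p k = p * k * xEq β h p k := by
  unfold lEq xEq
  ring

theorem wEq_eq (hpk : p * k ≠ 1) : wEq β h p k = h * β := by
  have hpk' := sub_ne_zero.2 hpk
  unfold wEq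
  field_simp

theorem lEq_eq_xEq_add (hpk : p * k ≠ 1) : lEq β h p k = xEq β h p k + h * β := by
  have hpk' := sub_ne_zero.2 hpk
  unfold lEq xEq
  field_simp
  ring

theorem wEq_eq_sub (hpk : p * k ≠ 1) : wEq β h p k = lEq β h p k - xEq β h p k := by
  rw [wEq_eq hpk, lEq_eq_xEq_add hpk, add_sub_cancel_left]

theorem xEq_pos (hβ : 0 < β) (hh : 0 < h) (hpk : 1 < p * k) : 0 < xEq β h p k :=
  div_pos (mul_pos hh hβ) (sub_pos.2 hpk)

theorem lEq_pos (hβ : 0 < β) (hh : 0 < h) (hpk : 1 < p * k) : 0 < lEq β h p k := by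
  rw [lEq_eq_mul_xEq]
  exact mul_pos (one_pos.trans hpk) (xEq_pos hβ hh hpk)

theorem wEq_pos (hβ : 0 < β) (hh : 0 < h) (hpk : 1 < p * k) : 0 < wEq β h p k := by
  rw [wEq_eq hpk.ne']
  exact mul_pos hh hβ

theorem drift_eq {X L : ℝ} (hL : L ≠ 0) :
    β - p * β * selectionRate k X L
      = β / L * ((L - lEq β h p k) - p * k * (X - xEq β h p k)) := by
  rw [lEq_eq_mul_xEq, selectionRate]
  field_simp
  ring

theorem mul_selectionRate_xEq_lEq (hl : lEq β h p k ≠ 0) :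
    p * β * selectionRate k (xEq β h p k) (lEq β h p k) = β := by
  have hdrift := drift_eq (β := β) (h := h) (p := p) (k := k) (X := xEq β h p k) hl
  rw [sub_self, sub_self, mul_zero, sub_zero, mul_zero] at hdrift
  exact (sub_eq_zero.1 hdrift).symm

theorem isTangleSolution_const_iff_balance (hh : 0 ≤ h) (x₀ l₀ w₀ : ℝ) :
    IsTangleSolution (fun _ => β) h p k (fun _ => x₀) (fun _ => l₀) (fun _ => w₀) ↔
      l₀ ≠ 0 ∧ p * β * selectionRate k x₀ l₀ = β ∧ w₀ = l₀ - x₀ ∧ w₀ = h * β := by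
  constructor
  · intro H
    have H1 := H 1 one_pos
    have h0 : (0 : ℝ) ∈ Icc (-h) 1 := ⟨neg_nonpos.2 hh, zero_le_one⟩
    have hdrift : β - p * β * selectionRate k x₀ l₀ = 0 :=
      (H1.deriv_x (1 / 2) (by norm_num)).unique (hasDerivAt_const _ _)
    have hu : p * β * selectionRate k x₀ l₀ = β := (sub_eq_zero.1 hdrift).symm
    refine ⟨H1.l_ne_zero 0 h0, hu, H1.w_eq_sub 0 h0, ?_⟩
    simpa [hu] using H1.w_eq_integral 0 ⟨le_rfl, zero_le_one⟩
  · rintro ⟨hl, hu, hw, hw'⟩ T -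
    exact
      { continuousOn_x := continuousOn_const
        continuousOn_l := continuousOn_const
        l_ne_zero := fun _ _ => hl
        deriv_x := fun t _ => by simpa [hu] using hasDerivAt_const t x₀
        deriv_l := fun t _ => by simpa [hu] using hasDerivAt_const t l₀
        w_eq_sub := fun _ _ => hw
        w_eq_integral := fun _ _ => by simpa [hu] using hw' }

theorem isTangleSolution_const_iff (hβ : 0 < β) (hh : 0 < h) (hpk : 1 < p * k) (x₀ l₀ w₀ : ℝ) :
    IsTangleSolution (fun _ => β) h p k (fun _ => x₀) (fun _ => l₀) (fun _ => w₀) ↔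
      x₀ = xEq β h p k ∧ l₀ = lEq β h p k ∧ w₀ = wEq β h p k := by
  rw [isTangleSolution_const_iff_balance hh.le]
  constructor
  · rintro ⟨hl, hu, hw, hw'⟩
    have hlx : l₀ = p * k * x₀ := by
      rw [selectionRate] at hu
      field_simp at hu
      linarith
    have hx : x₀ = xEq β h p k := by
      rw [xEq, eq_div_iff (sub_pos.2 hpk).ne']
      linarith
    exact ⟨hx, by rw [hlx, hx, lEq_eq_mul_xEq], by rw [hw', wEq_eq hpk.ne']⟩
  · rintro ⟨rfl, rfl, rfl⟩
    have hl := (lEq_pos hβ hh hpk).ne'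
    exact ⟨hl, mul_selectionRate_xEq_lEq hl, wEq_eq_sub hpk.ne', wEq_eq hpk.ne'⟩

end Equilibrium

section Linear

variable {V : Type*} [NormedAddCommGroup V] [NormedSpace ℝ V] {β h p k x₀ l₀ : ℝ}

theorem selectionRateLin_eq (ζ θ : V) :
    selectionRateLin k x₀ l₀ ζ θ = (k / l₀) • ζ - (k * x₀ / l₀ ^ 2) • θ := by
  have hx : deriv (fun x => selectionRate k x l₀) x₀ = k / l₀ := by
    simp [selectionRate]
  have hl : deriv (fun l => selectionRate k x₀ l) l₀ = -(k * x₀ / l₀ ^ 2) := by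
    simp [selectionRate, div_eq_mul_inv]
  rw [selectionRateLin, hx, hl, neg_smul, sub_eq_add_neg]

theorem neg_smul_selectionRateLin_xEq_lEq (ζ θ : V) :
    -((p * β) • selectionRateLin k (xEq β h p k) (lEq β h p k) ζ θ)
      = (β / lEq β h p k) • (θ - (p * k) • ζ) := by
  have hθ : p * β * (k * xEq β h p k / lEq β h p k ^ 2) = β / lEq β h p k := by
    calc p * β * (k * xEq β h p k / lEq β h p k ^ 2)
        = β * (p * k * xEq β h p k) / lEq β h p k ^ 2 := by ring
      _ = β / lEq β h p k := by
        rw [← lEq_eq_mul_xEq, pow_two, mul_div_assoc, div_self_mul_self', div_eq_mul_inv]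
  rw [selectionRateLin_eq, smul_sub, neg_sub, smul_smul, smul_smul, hθ, smul_sub, smul_smul]
  congr 2
  ring

theorem IsLinearizedSolution.θ_eq_delay [CompleteSpace V] {ζ θ η : ℝ → V} (hh : 0 ≤ h)
    (H : IsLinearizedSolution β h p k x₀ l₀ ζ θ η) {t : ℝ} (ht : h ≤ t) : θ t = ζ (t - h) := by
  have hsub : Icc (t - h) t ⊆ Ici (-h) := fun s hs => mem_Ici.2 (by linarith [hs.1])
  have hζ := H.continuousOn_ζ.mono hsub
  have hθ := H.continuousOn_θ.mono hsub
  have hv : ContinuousOn (fun s => (p * β) • selectionRateLin k x₀ l₀ (ζ s) (θ s))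
      (Icc (t - h) t) := by
    unfold selectionRateLin
    fun_prop
  have hη : θ t - ζ t = ∫ s in (t - h)..t, (p * β) • selectionRateLin k x₀ l₀ (ζ s) (θ s) :=
    (H.η_eq_sub t (by linarith)).symm.trans (H.η_eq_integral t (by linarith))
  rw [integral_eq_of_hasDerivAt_const_sub (e := 0) (sub_le_self t hh) hζ
    hv (fun s hs => (H.deriv_ζ s (by linarith [hs.1])).congr_deriv (zero_sub _).symm)] at hη
  simpa using hη

theorem IsLinearizedSolution.isDelayRelaxationOn {ζ θ η : ℝ → ℝ} (hh : 0 ≤ h)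
    (H : IsLinearizedSolution β h p k (xEq β h p k) (lEq β h p k) ζ θ η) (T : ℝ) :
    IsDelayRelaxationOn h (p * k) T (fun _ => β / lEq β h p k) θ ζ where
  continuousOn := H.continuousOn_ζ.mono fun _ hs => (neg_nonpos.2 hh).trans hs.1
  hasDerivAt t ht := (H.deriv_ζ t ht.1).congr_deriv (neg_smul_selectionRateLin_xEq_lEq _ _)
  eq_delay _ ht := H.θ_eq_delay hh ht.1

theorem isLinearlyStable_xEq_lEq (hβ : 0 < β) (hh : 0 < h) (hpk : 1 < p * k) :
    IsLinearlyStable β h p k (xEq β h p k) (lEq β h p k) := by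
  intro ζ θ η H
  have hsub : Icc 0 h ⊆ Ici (-h) := fun s hs => mem_Ici.2 (by linarith [hs.1])
  obtain ⟨C, hC⟩ := isCompact_Icc.exists_bound_of_continuousOn (H.continuousOn_θ.mono hsub)
  obtain ⟨hζ, hθ⟩ := IsDelayRelaxationOn.tendsto_zero (ρ := max |ζ 0| C)
    (fun T _ => H.isDelayRelaxationOn hh.le T) hh hpk (div_pos hβ (lEq_pos hβ hh hpk))
    (le_max_left _ _) (fun t ht => (hC t ht).trans (le_max_right _ _)) (fun _ _ _ => le_rfl)
  have hη : Tendsto η atTop (𝓝 0) := by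
    refine Tendsto.congr' ?_ (by simpa using hθ.sub hζ)
    exact (eventually_ge_atTop (-h)).mono fun t ht => (H.η_eq_sub t ht).symm
  simpa using hζ.abs.max (hθ.abs.max hη.abs)

end Linear

section Spectrum

variable {β h p k x₀ l₀ : ℝ}

theorem selectionRateLin_mul (e ζ θ : ℂ) :
    selectionRateLin k x₀ l₀ (e * ζ) (e * θ) = e * selectionRateLin k x₀ l₀ ζ θ := by
  simp only [selectionRateLin, mul_add, mul_smul_comm]

theorem hasDerivAt_cexp_mul_const (z ζ : ℂ) (t : ℝ) :
    HasDerivAt (fun t : ℝ => Complex.exp (z * t) * ζ) (Complex.exp (z * t) * (z * ζ)) t :=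
  (((hasDerivAt_id' (t : ℂ)).const_mul z).cexp.comp_ofReal.mul_const ζ).congr_deriv (by ring)

theorem cexp_mul_sub (z : ℂ) (t h : ℝ) :
    Complex.exp (z * (t - h : ℝ)) = Complex.exp (z * t) * Complex.exp (-(h * z)) := by
  rw [← Complex.exp_add]
  push_cast
  ring_nf

theorem isLinearizedSolution_cexp (hh : 0 ≤ h) {z ζ θ η : ℂ}
    (hζ : z * ζ = -((p * β) • selectionRateLin k x₀ l₀ ζ θ))
    (hθ : θ = Complex.exp (-(h * z)) * ζ) (hη : η = θ - ζ) :
    IsLinearizedSolution β h p k x₀ l₀ (fun t : ℝ => Complex.exp (z * t) * ζ)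
      (fun t : ℝ => Complex.exp (z * t) * θ) (fun t : ℝ => Complex.exp (z * t) * η) := by
  have hrate (t : ℝ) : -((p * β) • selectionRateLin k x₀ l₀ (Complex.exp (z * t) * ζ)
      (Complex.exp (z * t) * θ)) = Complex.exp (z * t) * (z * ζ) := by
    rw [selectionRateLin_mul, ← mul_smul_comm, ← mul_neg, hζ]
  have hdelay (t : ℝ) : Complex.exp (z * (t - h : ℝ)) * ζ = Complex.exp (z * t) * θ := by
    rw [cexp_mul_sub, mul_assoc, hθ]
  have hderiv (t : ℝ) : HasDerivAt (fun t : ℝ => Complex.exp (z * t) * ζ)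
      (-((p * β) • selectionRateLin k x₀ l₀ (Complex.exp (z * t) * ζ)
        (Complex.exp (z * t) * θ))) t := by
    rw [hrate]
    exact hasDerivAt_cexp_mul_const z ζ t
  exact
    { continuousOn_ζ := by fun_prop
      continuousOn_θ := by fun_prop
      deriv_ζ := fun t _ => hderiv t
      deriv_θ := fun t _ => by
        rw [hrate, mul_left_comm, hdelay, mul_left_comm]
        exact hasDerivAt_cexp_mul_const z θ t
      η_eq_sub := fun t _ => by rw [hη, mul_sub]
      η_eq_integral := fun t _ => by
        rw [integral_eq_of_hasDerivAt_const_sub (e := 0) (sub_le_self t hh) (by fun_prop)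
          (by unfold selectionRateLin; fun_prop)
          (fun s _ => (hderiv s).congr_deriv (zero_sub _).symm), hdelay, hη]
        simp only [smul_zero]
        ring }

theorem isLinearizedSolution_cexp_iff (hh : 0 < h) (z ζ θ η : ℂ) :
    IsLinearizedSolution β h p k x₀ l₀ (fun t : ℝ => Complex.exp (z * t) * ζ)
        (fun t : ℝ => Complex.exp (z * t) * θ) (fun t : ℝ => Complex.exp (z * t) * η) ↔
      z * ζ = -((p * β) • selectionRateLin k x₀ l₀ ζ θ) ∧
        θ = Complex.exp (-(h * z)) * ζ ∧ η = θ - ζ := by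
  refine ⟨fun H => ⟨?_, ?_, ?_⟩, fun ⟨hζ, hθ, hη⟩ => isLinearizedSolution_cexp hh.le hζ hθ hη⟩
  · have hζ := (hasDerivAt_cexp_mul_const z ζ h).unique (H.deriv_ζ h hh)
    rw [selectionRateLin_mul, ← mul_smul_comm, ← mul_neg] at hζ
    exact mul_left_cancel₀ (Complex.exp_ne_zero _) hζ
  · have hθ := H.θ_eq_delay hh.le le_rfl
    rw [cexp_mul_sub, mul_assoc] at hθ
    exact mul_left_cancel₀ (Complex.exp_ne_zero _) hθ
  · simpa using H.η_eq_sub 0 (neg_nonpos.2 hh.le)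

theorem mem_linearizedSpectrum_iff (hh : 0 < h) (z : ℂ) :
    z ∈ linearizedSpectrum β h p k x₀ l₀ ↔
      z = -((p * β) • selectionRateLin k x₀ l₀ 1 (Complex.exp (-(h * z)))) := by
  have hfactor (ζ : ℂ) : -((p * β) • selectionRateLin k x₀ l₀ ζ (Complex.exp (-(h * z)) * ζ))
      = -((p * β) • selectionRateLin k x₀ l₀ 1 (Complex.exp (-(h * z)))) * ζ := by
    rw [neg_mul, smul_mul_assoc, mul_comm _ ζ, mul_comm _ ζ, ← selectionRateLin_mul, mul_one]
  simp only [linearizedSpectrum, mem_ofPred_eq, isLinearizedSolution_cexp_iff hh]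
  constructor
  · rintro ⟨ζ, θ, η, hne, hζ, rfl, rfl⟩
    have hζ0 : ζ ≠ 0 := by
      rintro rfl
      simp at hne
    rw [hfactor] at hζ
    exact mul_right_cancel₀ hζ0 hζ
  · intro hz
    refine ⟨1, Complex.exp (-(h * z)), Complex.exp (-(h * z)) - 1, by simp, ?_, by simp, rfl⟩
    rwa [mul_one]

theorem mem_linearizedSpectrum_xEq_lEq_iff (hβ : 0 < β) (hh : 0 < h) (hpk : 1 < p * k) (z : ℂ) :
    z ∈ linearizedSpectrum β h p k (xEq β h p k) (lEq β h p k) ↔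
      ((p * k : ℝ) : ℂ) + ((p * k / (p * k - 1) : ℝ) : ℂ) * (h * z) = Complex.exp (-(h * z)) := by
  have hl := (lEq_pos hβ hh hpk).ne'
  have hcoef : p * k / (p * k - 1) * h = lEq β h p k / β := by
    unfold lEq
    field_simp
  have hβ' : (β : ℂ) ≠ 0 := Complex.ofReal_ne_zero.2 hβ.ne'
  have hl' : (lEq β h p k : ℂ) ≠ 0 := Complex.ofReal_ne_zero.2 hl
  rw [mem_linearizedSpectrum_iff hh, neg_smul_selectionRateLin_xEq_lEq, ← mul_assoc,
    ← Complex.ofReal_mul, hcoef, Complex.real_smul, Complex.real_smul, Complex.ofReal_div,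
    Complex.ofReal_div, mul_one, ← eq_sub_iff_add_eq']
  field_simp

theorem re_neg_of_characteristic {c : ℝ} (hh : 0 ≤ h) (hc : 1 < c) {z : ℂ}
    (hz : (c : ℂ) + ((c / (c - 1) : ℝ) : ℂ) * (h * z) = Complex.exp (-(h * z))) : z.re < 0 := by
  by_contra! hre
  have hexp : (Complex.exp (-(h * z))).re ≤ 1 := by
    refine (Complex.re_le_norm _).trans ?_
    rw [Complex.norm_exp, Real.exp_le_one_iff]
    simpa using mul_nonneg hh hre
  have hc_le : c ≤ ((c : ℂ) + ((c / (c - 1) : ℝ) : ℂ) * (h * z)).re := by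
    rw [Complex.add_re, Complex.re_ofReal_mul, Complex.re_ofReal_mul, Complex.ofReal_re]
    exact le_add_of_nonneg_right
      (mul_nonneg (div_nonneg (by linarith) (by linarith)) (mul_nonneg hh hre))
  rw [hz] at hc_le
  linarith

end Spectrum

section Nonlinear

variable {β h p k T : ℝ} {x l w : ℝ → ℝ}

theorem IsTangleSolutionOn.l_eq_delay (hh : 0 ≤ h)
    (H : IsTangleSolutionOn (fun _ => β) h p k T x l w) {t : ℝ} (ht : t ∈ Icc h T) :
    l t = x (t - h) + h * β := by
  have hsub : Icc (t - h) t ⊆ Icc (-h) T := Icc_subset_Icc (by linarith [ht.1]) ht.2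
  have hx := H.continuousOn_x.mono hsub
  have hv : ContinuousOn (fun s => p * β * selectionRate k (x s) (l s)) (Icc (t - h) t) := by
    unfold selectionRate
    exact continuousOn_const.mul ((continuousOn_const.mul hx).div
      (H.continuousOn_l.mono hsub) fun s hs => H.l_ne_zero s (hsub hs))
  have ht0 : 0 ≤ t := hh.trans ht.1
  have hw : l t - x t = ∫ s in (t - h)..t, p * β * selectionRate k (x s) (l s) :=
    (H.w_eq_sub t ⟨by linarith, ht.2⟩).symm.trans (H.w_eq_integral t ⟨ht0, ht.2⟩)
  rw [integral_eq_of_hasDerivAt_const_sub (sub_le_self t hh) hx hv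
    (fun s hs => H.deriv_x s ⟨by linarith [hs.1, ht.1], hs.2.trans_le ht.2⟩), smul_eq_mul] at hw
  linarith

theorem IsTangleSolutionOn.isDelayRelaxationOn (hh : 0 ≤ h) (hpk : p * k ≠ 1)
    (H : IsTangleSolutionOn (fun _ => β) h p k T x l w) :
    IsDelayRelaxationOn h (p * k) T (fun t => β / l t) (fun t => l t - lEq β h p k)
      (fun t => x t - xEq β h p k) where
  continuousOn := (H.continuousOn_x.mono (Icc_subset_Icc_left (neg_nonpos.2 hh))).sub
    continuousOn_const
  hasDerivAt t ht := ((H.deriv_x t ht).sub_const _).congr_deriv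
    (drift_eq (H.l_ne_zero t ⟨by linarith [ht.1], ht.2.le⟩))
  eq_delay t ht := by
    rw [H.l_eq_delay hh ht, lEq_eq_xEq_add hpk, add_sub_add_right_eq_sub]

theorem div_two_mul_le_div_of_abs_sub_le {a b L : ℝ} (hb : 0 ≤ b) (ha : 0 < a)
    (hL : |L - a| ≤ a / 2) : b / (2 * a) ≤ b / L := by
  obtain ⟨hlow, hupp⟩ := abs_le.1 hL
  exact div_le_div_of_nonneg_left hb (by linarith) (by linarith)

theorem exists_abs_drift_lt (hl : lEq β h p k ≠ 0) {ε : ℝ} (hε : 0 < ε) :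
    ∃ δ > 0, ∀ X L, |X - xEq β h p k| < δ → |L - lEq β h p k| < δ →
      |β - p * β * selectionRate k X L| < ε := by
  have hcont : ContinuousAt (fun q : ℝ × ℝ => β - p * β * selectionRate k q.1 q.2)
      (xEq β h p k, lEq β h p k) :=
    continuousAt_const.sub (continuousAt_const.mul
      ((continuousAt_const.mul continuousAt_fst).div continuousAt_snd hl))
  obtain ⟨δ, hδ, hclose⟩ := Metric.continuousAt_iff.1 hcont ε hε
  refine ⟨δ, hδ, fun X L hX hL => ?_⟩
  simpa [Real.dist_eq, mul_selectionRate_xEq_lEq hl] using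
    hclose (x := (X, L)) (max_lt hX hL)

theorem exists_initiallyClose_imp_abs_sub_le_until_delay (hh : 0 < h) (hl : lEq β h p k ≠ 0)
    {ρ : ℝ} (hρ : 0 < ρ) (w₀ : ℝ) :
    ∃ δ > 0, ∀ T x l w, IsTangleSolutionOn (fun _ => β) h p k T x l w →
      InitiallyClose h δ (xEq β h p k) (lEq β h p k) w₀ x l w →
        |x 0 - xEq β h p k| ≤ ρ ∧ ∀ t ∈ Icc 0 T, t ≤ h → |l t - lEq β h p k| ≤ ρ := by
  obtain ⟨δ, hδ, hdrift⟩ := exists_abs_drift_lt hl (ε := ρ / (2 * h)) (by positivity)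
  refine ⟨min δ (ρ / 2), by positivity, fun T x l w H H0 => ?_⟩
  obtain ⟨hx0, hl0, -⟩ := H0 0 ⟨by linarith, le_rfl⟩
  refine ⟨hx0.le.trans ((min_le_right _ _).trans (by linarith)), fun t ht hth => ?_⟩
  have hslope : ∀ s ∈ Ioo 0 t,
      |β - p * β * selectionRate k (x (s - h)) (l (s - h))| ≤ ρ / (2 * h) := by
    intro s hs
    obtain ⟨hxs, hls, -⟩ := H0 (s - h) ⟨by linarith [hs.1], by linarith [hs.2]⟩
    exact (hdrift _ _ (hxs.trans_le (min_le_left _ _)) (hls.trans_le (min_le_left _ _))).le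
  calc |l t - lEq β h p k| ≤ |l t - l 0| + |l 0 - lEq β h p k| := abs_sub_le _ _ _
    _ ≤ ρ / (2 * h) * (t - 0) + ρ / 2 := add_le_add
        (abs_sub_le_of_abs_deriv_le ht.1
          (H.continuousOn_l.mono (Icc_subset_Icc (by linarith) ht.2))
          (fun s hs => H.deriv_l s ⟨hs.1, hs.2.trans_le ht.2⟩) hslope)
        (hl0.le.trans (min_le_right _ _))
    _ ≤ ρ / (2 * h) * h + ρ / 2 := by
        gcongr
        linarith
    _ = ρ := by
        field_simp
        ring

theorem exists_initiallyClose_imp_abs_sub_lt (hβ : 0 < β) (hh : 0 < h) (hpk : 1 < p * k) {ε : ℝ}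
    (hε : 0 < ε) :
    ∃ δ > 0, ∀ T x l w, IsTangleSolutionOn (fun _ => β) h p k T x l w →
      InitiallyClose h δ (xEq β h p k) (lEq β h p k) (wEq β h p k) x l w →
        ∀ t ∈ Icc 0 T, |x t - xEq β h p k| < ε ∧ |l t - lEq β h p k| < ε ∧
          |w t - wEq β h p k| < ε := by
  have hl := lEq_pos hβ hh hpk
  set ρ := min (ε / 3) (lEq β h p k / 2)
  have hρε : ρ ≤ ε / 3 := min_le_left _ _
  have hρl : ρ ≤ lEq β h p k / 2 := min_le_right _ _
  obtain ⟨δ, hδ, hclose⟩ := exists_initiallyClose_imp_abs_sub_le_until_delay hh hl.ne'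
    (by positivity : 0 < ρ) (wEq β h p k)
  refine ⟨δ, hδ, fun T x l w H H0 t ht => ?_⟩
  obtain ⟨hx0, hlh⟩ := hclose T x l w H H0
  obtain ⟨hxt, hlt⟩ := (H.isDelayRelaxationOn hh.le hpk.ne').abs_le hh hpk.le
    (by positivity : 0 < β / (2 * lEq β h p k)) hx0 hlh
    (fun s _ hs => div_two_mul_le_div_of_abs_sub_le hβ.le hl (hs.trans hρl)) t ht
  refine ⟨by linarith, by linarith, ?_⟩
  rw [H.w_eq_sub t ⟨by linarith [ht.1], ht.2⟩, wEq_eq_sub hpk.ne', sub_sub_sub_comm]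
  linarith [abs_sub (l t - lEq β h p k) (x t - xEq β h p k)]

theorem exists_initiallyClose_imp_tendsto (hβ : 0 < β) (hh : 0 < h) (hpk : 1 < p * k) :
    ∃ δ > 0, ∀ x l w, IsTangleSolution (fun _ => β) h p k x l w →
      InitiallyClose h δ (xEq β h p k) (lEq β h p k) (wEq β h p k) x l w →
        Tendsto x atTop (𝓝 (xEq β h p k)) ∧ Tendsto l atTop (𝓝 (lEq β h p k)) ∧
          Tendsto w atTop (𝓝 (wEq β h p k)) := by
  have hl := lEq_pos hβ hh hpk
  obtain ⟨δ, hδ, hclose⟩ := exists_initiallyClose_imp_abs_sub_le_until_delay hh hl.ne' (half_pos hl)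
    (wEq β h p k)
  refine ⟨δ, hδ, fun x l w H H0 => ?_⟩
  obtain ⟨hx0, hlh⟩ := hclose h x l w (H h hh) H0
  obtain ⟨hx, hl⟩ := IsDelayRelaxationOn.tendsto_zero
    (fun T hT => (H T hT).isDelayRelaxationOn hh.le hpk.ne') hh hpk
    (by positivity : 0 < β / (2 * lEq β h p k)) hx0 (fun t ht => hlh t ht ht.2)
    (fun t _ => div_two_mul_le_div_of_abs_sub_le hβ.le hl)
  rw [tendsto_sub_nhds_zero_iff] at hx hl
  refine ⟨hx, hl, ?_⟩
  rw [wEq_eq_sub hpk.ne']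
  refine (hl.sub hx).congr' ((eventually_gt_atTop 0).mono fun t ht => ?_)
  exact ((H t ht).w_eq_sub t ⟨by linarith, le_rfl⟩).symm

theorem isLocallyAsymptoticallyStable_equilibrium (hβ : 0 < β) (hh : 0 < h) (hpk : 1 < p * k) :
    IsLocallyAsymptoticallyStable (fun _ => β) h p k
      (xEq β h p k) (lEq β h p k) (wEq β h p k) where
  stable ε hε := by
    obtain ⟨δ, hδ, hstable⟩ := exists_initiallyClose_imp_abs_sub_lt hβ hh hpk hε
    exact ⟨δ, hδ, fun T _ => hstable T⟩
  attractive := exists_initiallyClose_imp_tendsto hβ hh hpk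

end Nonlinear

theorem theorem1_general (β h p k : ℝ) (hβ : 0 < β) (hh : 0 < h) (hpk : 0 < p * k - 1) :
    (∀ x₀ l₀ w₀ : ℝ,
      IsTangleSolution (fun _ => β) h p k (fun _ => x₀) (fun _ => l₀) (fun _ => w₀) ↔
        x₀ = xEq β h p k ∧ l₀ = lEq β h p k ∧ w₀ = wEq β h p k) ∧
    0 < xEq β h p k ∧ 0 < lEq β h p k ∧ 0 < wEq β h p k ∧
    IsLinearlyStable β h p k (xEq β h p k) (lEq β h p k) ∧
    (∀ z : ℂ, z ∈ linearizedSpectrum β h p k (xEq β h p k) (lEq β h p k) ↔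
      ((p * k : ℝ) : ℂ) + ((p * k / (p * k - 1) : ℝ) : ℂ) * (h * z) = Complex.exp (-(h * z))) ∧
    (∀ z ∈ linearizedSpectrum β h p k (xEq β h p k) (lEq β h p k), z.re < 0) ∧
    IsLocallyAsymptoticallyStable (fun _ => β) h p k
      (xEq β h p k) (lEq β h p k) (wEq β h p k) := by
  have hc : 1 < p * k := sub_pos.1 hpk
  have hspec := mem_linearizedSpectrum_xEq_lEq_iff hβ hh hc
  exact ⟨isTangleSolution_const_iff hβ hh hc, xEq_pos hβ hh hc, lEq_pos hβ hh hc,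
    wEq_pos hβ hh hc, isLinearlyStable_xEq_lEq hβ hh hc, hspec,
    fun z hz => re_neg_of_characteristic hh.le hc ((hspec z).1 hz),
    isLocallyAsymptoticallyStable_equilibrium hβ hh hc⟩

theorem theorem1 (β h p k : ℝ) (hβ : 0 < β) (hh : 0 < h) (hp : p ∈ Set.Icc (0 : ℝ) 1)
    (hk : 0 < k) (hpk : 0 < p * k - 1) :
    -- the given triple is the unique constant solution, and it is positive
    (∀ x₀ l₀ w₀ : ℝ,
      IsTangleSolution (fun _ => β) h p k (fun _ => x₀) (fun _ => l₀) (fun _ => w₀) ↔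
        x₀ = xEq β h p k ∧ l₀ = lEq β h p k ∧ w₀ = wEq β h p k) ∧
    0 < xEq β h p k ∧ 0 < lEq β h p k ∧ 0 < wEq β h p k ∧
    -- every solution of the linearised system tends to zero
    IsLinearlyStable β h p k (xEq β h p k) (lEq β h p k) ∧
    -- the spectrum is given by the characteristic equation and has negative real parts
    (∀ z : ℂ, z ∈ linearizedSpectrum β h p k (xEq β h p k) (lEq β h p k) ↔
      ((p * k : ℝ) : ℂ) + ((p * k / (p * k - 1) : ℝ) : ℂ) * (h * z) = Complex.exp (-(h * z))) ∧
    (∀ z ∈ linearizedSpectrum β h p k (xEq β h p k) (lEq β h p k), z.re < 0) ∧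
    -- the equilibrium of the nonlinear system is locally asymptotically stable
    IsLocallyAsymptoticallyStable (fun _ => β) h p k
      (xEq β h p k) (lEq β h p k) (wEq β h p k) := by
  exact theorem1_general β h p k hβ hh hpk
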